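/- Consider coloured integers $k_z$ with $k\ge 1$ an integer and $z$ one of the four colours $a,b,c,d$, ordered by $$1_a<1_b<1_c<1_d<2_a<2_b<2_c<2_d<\cdots.$$ Let $$D=\begin{pmatrix}2&1&2&2\\1&0&1&1\\0&1&0&2\\0&1&0&2\end{pmatrix},$$ with rows and columns indexed by $a,b,c,d$ in this order. Consider finite (possibly empty) sequences $(\lambda_1,\lambda_2,\dots,\lambda_s)$ of coloured integers, weakly decreasing in the above order, such that for all $1\le i<s$, if $\lambda_i$ has colour $x$ and $\lambda_{i+1}$ has colour $y$, then the size of $\lambda_i$ minus the size of $\lambda_{i+1}$ is at least the entry $D(x,y)$ in row $x$ and column $y$. For integers $n,k,\ell,m\ge 0$ let $A(n;k,\ell,m)$ be the (finite) number of such sequences whose sizes sum to $n$ and which have exactly $k$ parts coloured $a$, $\ell$ parts coloured $c$ and $m$ parts coloured $d$ (and any number of parts coloured $b$). Then, as formal power series in $q,a,c,d$, $$\sum_{n,k,\ell,m\ge 0}A(n;k,\ell,m)\,q^n a^k c^\ell d^m=\frac{(-aq;q^2)_\infty(-dq;q^2)_\infty}{(q;q)_\infty(cq;q^2)_\infty},$$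 where $(x;y)_\infty=\prod_{j\ge 0}(1-xy^j)$. -/

import Mathlib

open scoped MvPowerSeries.WithPiTopology

namespace PrimcPartition

/-- The four colours. -/
inductive Colour : Type
  | a | b | c | d
  deriving DecidableEq

/-- The rank of a colour in the order `a < b < c < d` (used for parts of equal size). -/
def Colour.rank : Colour → ℕ
  | .a => 0
  | .b => 1
  | .c => 2
  | .d => 3

/-- A coloured integer `k_z`: the size `k` together with the colour `z`. -/
structure Part : Type where
  size : ℕ
  colour : Colour
  deriving DecidableEq

/-- The order `1_a < 1_b < 1_c < 1_d < 2_a < 2_b < 2_c < 2_d < ⋯`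
(non-strict version). -/
def Part.le (x y : Part) : Prop :=
  x.size < y.size ∨ (x.size = y.size ∧ x.colour.rank ≤ y.colour.rank)

/-- The matrix of minimal differences: row `x` is the colour of the larger part `λ_i`,
column `y` is the colour of the following part `λ_{i+1}`. -/
def D : Colour → Colour → ℕ
  | .a, .a => 2 | .a, .b => 1 | .a, .c => 2 | .a, .d => 2
  | .b, .a => 1 | .b, .b => 0 | .b, .c => 1 | .b, .d => 1
  | .c, .a => 0 | .c, .b => 1 | .c, .c => 0 | .c, .d => 2
  | .d, .a => 0 | .d, .b => 1 | .d, .c => 0 | .d, .d => 2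

/-- A finite list `(λ_1, λ_2, …)` of coloured integers is a four-coloured partition with
difference conditions `D`: its parts are positive, it is weakly decreasing in the order of
coloured integers, and `λ_i - λ_{i+1} ≥ D(colour of λ_i, colour of λ_{i+1})` for all `i`
(the inequality is written additively). -/
structure IsPartition (l : List Part) : Prop where
  pos : ∀ x ∈ l, 1 ≤ x.size
  decreasing : l.Pairwise (fun x y => y.le x)
  difference : l.IsChain (fun x y => y.size + D x.colour y.colour ≤ x.size)

/-- The number of parts of colour `z`. -/
def count (z : Colour) (l : List Part) : ℕ :=
  l.countP (fun x => decide (x.colour = z))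

/-- The partitions of `n` satisfying the difference conditions, with `k` parts coloured `a`,
`ℓ` parts coloured `c` and `m` parts coloured `d` (and any number of parts coloured `b`). -/
def partitions (n k ℓ m : ℕ) : Set (List Part) :=
  {l | IsPartition l ∧ (l.map Part.size).sum = n ∧
    count .a l = k ∧ count .c l = ℓ ∧ count .d l = m}

/-- The number `A(n; k, ℓ, m)`. -/
noncomputable def A (n k ℓ m : ℕ) : ℕ := (partitions n k ℓ m).ncard

/-- Names of the four commuting indeterminates. -/
inductive Var : Type
  | q | a | c | d
  deriving DecidableEq

/-- Formal power series in `q, a, c, d` with integer coefficients. The topology on it is that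
of coefficientwise convergence (`ℤ` being discrete). -/
abbrev Series : Type := MvPowerSeries Var ℤ

/-- An indeterminate as a power series. -/
noncomputable abbrev q : Series := MvPowerSeries.X Var.q
/-- An indeterminate as a power series. -/
noncomputable abbrev a : Series := MvPowerSeries.X Var.a
/-- An indeterminate as a power series. -/
noncomputable abbrev c : Series := MvPowerSeries.X Var.c
/-- An indeterminate as a power series. -/
noncomputable abbrev d : Series := MvPowerSeries.X Var.d

/-- The generating function `∑ A(n; k, ℓ, m) q^n a^k c^ℓ d^m`: the power series in which the
monomial `q^n a^k c^ℓ d^m` has coefficient `A(n; k, ℓ, m)`. -/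
noncomputable def genFun : Series :=
  fun e => (A (e Var.q) (e Var.a) (e Var.c) (e Var.d) : ℤ)

/-- The factors `1 - x y^j`, `j = 0, 1, 2, …`, of `(x; y)_∞`. -/
noncomputable def qFactor (x y : Series) (j : ℕ) : Series := 1 - x * y ^ j

/-- The infinite product `(x; y)_∞ = ∏_{j ≥ 0} (1 - x y^j)`. -/
noncomputable def qPoch (x y : Series) : Series := ∏' j : ℕ, qFactor x y j

end PrimcPartition

namespace PrimcPartition

/-! ### Explicit solution of the `q`-difference system and its limit modulo `q^N`. -/

section Algebra

variable {R : Type*} [CommRing R] (q a c d : R)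

/-- The coefficients `q^(n(n-1)/2) / (q;q)_n` of Euler's expansion of `(-x;q)_∞`. -/
noncomputable def eulerCoeff (n : ℕ) : R :=
  ∏ i ∈ Finset.range n, (q ^ i * Ring.inverse (1 - q ^ (i + 1)))

/-- `(-aq;q²)_n (-dq;q²)_n / ((q²;q²)_n (cq;q²)_n)`. -/
noncomputable def hyperCoeff (n : ℕ) : R :=
  ∏ i ∈ Finset.range n, ((1 + a * q ^ (2 * i + 1)) * (1 + d * q ^ (2 * i + 1)) *
    (Ring.inverse (1 - q ^ (2 * i + 2)) * Ring.inverse (1 - c * q ^ (2 * i + 1))))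

/-- `(1 + a q^(2n+1)) / (1 - c q^(2n+1))` times `hyperCoeff`. -/
noncomputable def hyperCoeffOdd (n : ℕ) : R :=
  (1 + a * q ^ (2 * n + 1)) * Ring.inverse (1 - c * q ^ (2 * n + 1)) * hyperCoeff q a c d n

variable {q a c d}

@[simp] lemma eulerCoeff_zero : eulerCoeff q 0 = 1 := by simp [eulerCoeff]

@[simp] lemma hyperCoeff_zero : hyperCoeff q a c d 0 = 1 := by simp [hyperCoeff]

lemma eulerCoeff_succ (hq : ∀ n, IsUnit (1 - q ^ (n + 1))) (n : ℕ) :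
    eulerCoeff q (n + 1) = q ^ (n + 1) * eulerCoeff q (n + 1) + q ^ n * eulerCoeff q n := by
  have h := Ring.mul_inverse_cancel _ (hq n)
  have h2 : eulerCoeff q (n + 1)
      = eulerCoeff q n * (q ^ n * Ring.inverse (1 - q ^ (n + 1))) :=
    Finset.prod_range_succ _ _
  rw [h2]
  linear_combination (eulerCoeff q n * q ^ n) * h

lemma hyperCoeff_succ (hq : ∀ n, IsUnit (1 - q ^ (n + 1)))
    (hc : ∀ n, IsUnit (1 - c * q ^ (2 * n + 1))) (n : ℕ) :
    hyperCoeff q a c d (n + 1) * (1 - q ^ (2 * n + 2)) * (1 - c * q ^ (2 * n + 1)) =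
      hyperCoeff q a c d n * (1 + a * q ^ (2 * n + 1)) * (1 + d * q ^ (2 * n + 1)) := by
  have h := Ring.mul_inverse_cancel _ (hq (2 * n + 1))
  have h' := Ring.mul_inverse_cancel _ (hc n)
  have h2 : hyperCoeff q a c d (n + 1) = hyperCoeff q a c d n * _ :=
    Finset.prod_range_succ _ _
  rw [h2]
  set u := Ring.inverse (1 - q ^ (2 * n + 1 + 1))
  set v := Ring.inverse (1 - c * q ^ (2 * n + 1))
  change (1 - q ^ (2 * n + 2)) * u = 1 at h
  change hyperCoeff q a c d n * ((1 + a * q ^ (2 * n + 1)) * (1 + d * q ^ (2 * n + 1)) *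
    (u * v)) * _ * _ = _
  linear_combination (hyperCoeff q a c d n * (1 + a * q ^ (2 * n + 1)) *
    (1 + d * q ^ (2 * n + 1))) * ((1 - c * q ^ (2 * n + 1)) * v * h + h')

lemma hyperCoeffOdd_mul (hc : ∀ n, IsUnit (1 - c * q ^ (2 * n + 1))) (n : ℕ) :
    hyperCoeffOdd q a c d n * (1 - c * q ^ (2 * n + 1)) =
      (1 + a * q ^ (2 * n + 1)) * hyperCoeff q a c d n := by
  have h := Ring.mul_inverse_cancel _ (hc n)
  rw [hyperCoeffOdd]
  linear_combination (1 + a * q ^ (2 * n + 1)) * hyperCoeff q a c d n * h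

/-- With `hyperCoeffOdd_mul`, this splits the step from `n` to `n + 1` into two: the factors in `a`
and `c` first, those in `d` and `q` second. The odd coefficients are the intermediate values. -/
lemma hyperCoeff_succ_eq_odd (hq : ∀ n, IsUnit (1 - q ^ (n + 1)))
    (hc : ∀ n, IsUnit (1 - c * q ^ (2 * n + 1))) (n : ℕ) :
    hyperCoeff q a c d (n + 1) * (1 - q ^ (2 * n + 2)) =
      hyperCoeffOdd q a c d n * (1 + d * q ^ (2 * n + 1)) := by
  apply (hc n).mul_right_cancel
  rw [hyperCoeff_succ hq hc]
  linear_combination -(1 + d * q ^ (2 * n + 1)) * hyperCoeffOdd_mul (a := a) (d := d) hc n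

variable (q a c d) in
/-- `∑ hyperCoeff n x^(2n)`. -/
noncomputable def evenSeries : PowerSeries R :=
  PowerSeries.mk fun m => if Even m then hyperCoeff q a c d (m / 2) else 0

variable (q a c d) in
/-- `∑ hyperCoeffOdd n x^(2n+1)`. -/
noncomputable def oddSeries : PowerSeries R :=
  PowerSeries.mk fun m => if Even m then 0 else hyperCoeffOdd q a c d (m / 2)

variable (q) in
/-- Euler's expansion of `(-x;q)_∞`. -/
noncomputable def eulerSeries : PowerSeries R := PowerSeries.mk (eulerCoeff q)

open PowerSeries in
lemma eulerSeries_eq (hq : ∀ n, IsUnit (1 - q ^ (n + 1))) :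
    eulerSeries q = (1 + X) * rescale q (eulerSeries q) := by
  ext n
  rcases n with _ | n
  · simp only [add_mul, one_mul, map_add, coeff_zero_X_mul, coeff_rescale]
    ring
  · simp only [add_mul, one_mul, map_add, coeff_succ_X_mul, coeff_rescale, eulerSeries, coeff_mk]
    exact eulerCoeff_succ hq n

lemma powerSeries_ext_of_even_odd {f g : PowerSeries R} (h0 : f.coeff 0 = g.coeff 0)
    (h1 : f.coeff 1 = g.coeff 1)
    (he : ∀ n, f.coeff (2 * n + 2) = g.coeff (2 * n + 2))
    (ho : ∀ n, f.coeff (2 * n + 3) = g.coeff (2 * n + 3)) : f = g := by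
  ext m
  rcases Nat.even_or_odd' m with ⟨n, rfl | rfl⟩ <;> rcases n with _ | n
  · exact h0
  · exact he n
  · exact h1
  · exact ho n

section
variable (n : ℕ)

@[simp] lemma coeff_evenSeries_even :
    (evenSeries q a c d).coeff (2 * n) = hyperCoeff q a c d n := by
  simp [evenSeries]

@[simp] lemma coeff_evenSeries_odd : (evenSeries q a c d).coeff (2 * n + 1) = 0 := by
  simp [evenSeries]

@[simp] lemma coeff_oddSeries_even : (oddSeries q a c d).coeff (2 * n) = 0 := by
  simp [oddSeries]

@[simp] lemma coeff_oddSeries_odd :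
    (oddSeries q a c d).coeff (2 * n + 1) = hyperCoeffOdd q a c d n := by
  have : (2 * n + 1) / 2 = n := by omega
  simp [oddSeries, this]

end

-- The coefficient of `X^(2n+2)` reduces to the two half-steps `hyperCoeffOdd_mul` and
-- `hyperCoeff_succ_eq_odd`; odd coefficients vanish by parity.
open PowerSeries in
lemma evenSeries_eq (hq : ∀ n, IsUnit (1 - q ^ (n + 1)))
    (hc : ∀ n, IsUnit (1 - c * q ^ (2 * n + 1))) :
    (1 - X ^ 2) * evenSeries q a c d =
      (1 + C (a * q) * X ^ 2) * rescale q (evenSeries q a c d) +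
        C (c + d) * (X * rescale q (oddSeries q a c d)) := by
  have e0 := coeff_evenSeries_even (q := q) (a := a) (c := c) (d := d) 0
  have e1 := coeff_evenSeries_odd (q := q) (a := a) (c := c) (d := d) 0
  have o0 := coeff_oddSeries_even (q := q) (a := a) (c := c) (d := d) 0
  rw [mul_zero] at e0 o0
  rw [mul_zero, zero_add] at e1
  have key : ∀ (f : PowerSeries R) n, coeff (n + 2) (X ^ 2 * f) = coeff n f := fun f n => by
    rw [coeff_X_pow_mul]
  have key0 : ∀ (f : PowerSeries R), coeff 0 (X ^ 2 * f) = 0 := fun f => by simp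
  have key1 : ∀ (f : PowerSeries R), coeff 1 (X ^ 2 * f) = 0 := fun f => by
    rw [coeff_X_pow_mul']; simp
  have k1 : ∀ (f : PowerSeries R), coeff 1 (X * f) = coeff 0 f := fun f => coeff_succ_X_mul 0 f
  apply powerSeries_ext_of_even_odd
  · simp only [sub_mul, add_mul, one_mul, mul_assoc, map_sub, map_add, coeff_C_mul, key0,
      coeff_zero_X_mul, coeff_rescale, e0]
    ring
  · simp only [sub_mul, add_mul, one_mul, mul_assoc, map_sub, map_add, coeff_C_mul, key1,
      k1, coeff_rescale, e1, o0]
    ring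
  · intro n
    have i1 : coeff (2 * n + 2) (evenSeries q a c d) = hyperCoeff q a c d (n + 1) :=
      coeff_evenSeries_even (n + 1)
    have i2 : ∀ f : PowerSeries R, coeff (2 * n + 2) (X * f) = coeff (2 * n + 1) f :=
      fun f => coeff_succ_X_mul _ f
    simp only [sub_mul, add_mul, one_mul, mul_assoc, map_sub, map_add, coeff_C_mul, key,
      i1, i2, coeff_rescale, coeff_evenSeries_even, coeff_oddSeries_odd]
    linear_combination hyperCoeff_succ_eq_odd (a := a) (d := d) hq hc n
      + hyperCoeffOdd_mul (a := a) (d := d) hc n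
  · intro n
    have i1 : coeff (2 * n + 3) (evenSeries q a c d) = 0 :=
      coeff_evenSeries_odd (n + 1)
    have i2 : ∀ f : PowerSeries R, coeff (2 * n + 3) (X * f) = coeff (2 * (n + 1)) f :=
      fun f => coeff_succ_X_mul _ f
    have i3 : ∀ f : PowerSeries R, coeff (2 * n + 3) (X ^ 2 * f) = coeff (2 * n + 1) f :=
      fun f => key f (2 * n + 1)
    simp only [sub_mul, add_mul, one_mul, mul_assoc, map_sub, map_add, coeff_C_mul, i3,
      i1, i2, coeff_rescale, coeff_evenSeries_odd, coeff_oddSeries_even]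
    ring

open PowerSeries in
lemma oddSeries_eq (hq : ∀ n, IsUnit (1 - q ^ (n + 1)))
    (hc : ∀ n, IsUnit (1 - c * q ^ (2 * n + 1))) :
    (1 - X ^ 2) * oddSeries q a c d =
      C (1 + a * q) * (X * rescale q (evenSeries q a c d)) +
        (C c + C d * X ^ 2) * rescale q (oddSeries q a c d) := by
  have e0 := coeff_evenSeries_even (q := q) (a := a) (c := c) (d := d) 0
  have o1 := coeff_oddSeries_odd (q := q) (a := a) (c := c) (d := d) 0
  have o0 := coeff_oddSeries_even (q := q) (a := a) (c := c) (d := d) 0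
  rw [mul_zero] at e0 o0
  rw [mul_zero, zero_add] at o1
  have key : ∀ (f : PowerSeries R) n, coeff (n + 2) (X ^ 2 * f) = coeff n f := fun f n => by
    rw [coeff_X_pow_mul]
  have key0 : ∀ (f : PowerSeries R), coeff 0 (X ^ 2 * f) = 0 := fun f => by simp
  have key1 : ∀ (f : PowerSeries R), coeff 1 (X ^ 2 * f) = 0 := fun f => by
    rw [coeff_X_pow_mul']; simp
  have k1 : ∀ (f : PowerSeries R), coeff 1 (X * f) = coeff 0 f := fun f => coeff_succ_X_mul 0 f
  apply powerSeries_ext_of_even_odd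
  · simp only [sub_mul, add_mul, one_mul, mul_assoc, map_sub, map_add, coeff_C_mul, key0,
      coeff_zero_X_mul, coeff_rescale, o0]
    ring
  · simp only [sub_mul, add_mul, one_mul, mul_assoc, map_sub, map_add, coeff_C_mul, key1,
      k1, coeff_rescale, e0, o1]
    have := hyperCoeffOdd_mul (a := a) (d := d) hc 0
    simp only [mul_zero, zero_add, pow_one] at this
    linear_combination this
  · intro n
    have i1 : coeff (2 * n + 2) (oddSeries q a c d) = 0 :=
      coeff_oddSeries_even (n + 1)
    have i2 : ∀ f : PowerSeries R, coeff (2 * n + 2) (X * f) = coeff (2 * n + 1) f :=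
      fun f => coeff_succ_X_mul _ f
    simp only [sub_mul, add_mul, one_mul, mul_assoc, map_sub, map_add, coeff_C_mul, key,
      i1, i2, coeff_rescale, coeff_evenSeries_odd, coeff_oddSeries_even]
    ring
  · intro n
    have i1 : coeff (2 * n + 3) (oddSeries q a c d) = hyperCoeffOdd q a c d (n + 1) :=
      coeff_oddSeries_odd (n + 1)
    have i2 : ∀ f : PowerSeries R, coeff (2 * n + 3) (X * f) = coeff (2 * (n + 1)) f :=
      fun f => coeff_succ_X_mul _ f
    have i3 : ∀ f : PowerSeries R, coeff (2 * n + 3) (X ^ 2 * f) = coeff (2 * n + 1) f :=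
      fun f => key f (2 * n + 1)
    simp only [sub_mul, add_mul, one_mul, mul_assoc, map_sub, map_add, coeff_C_mul, i3,
      i1, i2, coeff_rescale, coeff_evenSeries_even, coeff_oddSeries_odd]
    linear_combination hyperCoeffOdd_mul (a := a) (d := d) hc (n + 1)
      + hyperCoeff_succ_eq_odd (a := a) (d := d) hq hc n

variable (q a c d) in
/-- The closed form of the generating function `G(m) / (1 - q^m)`, where `G(m)` enumerates the
partitions with parts of size less than `m`. -/
noncomputable def boundedGF (m : ℕ) : R :=
  (eulerSeries q * evenSeries q a c d).coeff m

variable (q a c d) in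
/-- The closed form of the generating function of the partitions which may follow `m_c`. -/
noncomputable def followGF (m : ℕ) : R :=
  (eulerSeries q * oddSeries q a c d).coeff m

open PowerSeries in
lemma functional_equations (hq : ∀ n, IsUnit (1 - q ^ (n + 1)))
    (hc : ∀ n, IsUnit (1 - c * q ^ (2 * n + 1))) :
    (1 - X) * (eulerSeries q * evenSeries q a c d) =
      (1 + C (a * q) * X ^ 2) * rescale q (eulerSeries q * evenSeries q a c d) +
        C (c + d) * (X * rescale q (eulerSeries q * oddSeries q a c d)) ∧
    eulerSeries q * oddSeries q a c d =
      (C c - C d * X) * rescale q (eulerSeries q * oddSeries q a c d) +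
      C (a * q) * (X * rescale q (eulerSeries q * evenSeries q a c d)) +
      eulerSeries q * evenSeries q a c d -
      rescale q (eulerSeries q * evenSeries q a c d) := by
  have hE := eulerSeries_eq hq
  have hY := evenSeries_eq (a := a) (d := d) hq hc
  have hZ := oddSeries_eq (a := a) (d := d) hq hc
  have h1 : (1 - X) * (eulerSeries q * evenSeries q a c d) =
      (1 + C (a * q) * X ^ 2) * rescale q (eulerSeries q * evenSeries q a c d) +
        C (c + d) * (X * rescale q (eulerSeries q * oddSeries q a c d)) := by
    simp only [map_mul (rescale q)]
    -- The Euler factor turns `1 - X` into `1 - X²`: `(1 - X) E(X) = (1 - X²) E(qX)`.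
    linear_combination (1 - X) * evenSeries q a c d * hE + rescale q (eulerSeries q) * hY
  refine ⟨h1, ?_⟩
  have hu : IsUnit (1 - X : PowerSeries R) := by
    rw [PowerSeries.isUnit_iff_constantCoeff]; simp
  apply hu.mul_left_cancel
  simp only [map_mul (rescale q)] at h1 ⊢
  simp only [map_add, map_mul, map_one] at h1 hY hZ ⊢
  linear_combination (1 - X) * oddSeries q a c d * hE + rescale q (eulerSeries q) * hZ - h1

lemma boundedGF_zero : boundedGF q a c d 0 = 1 := by
  rw [boundedGF, PowerSeries.coeff_mul]
  simp [eulerSeries, evenSeries, -PowerSeries.coeff_zero_eq_constantCoeff]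

lemma followGF_zero : followGF q a c d 0 = 0 := by
  have e0 := coeff_oddSeries_even (q := q) (a := a) (c := c) (d := d) 0
  simp only [mul_zero, PowerSeries.coeff_zero_eq_constantCoeff] at e0
  simp [followGF, e0]

lemma boundedGF_one (hq : ∀ n, IsUnit (1 - q ^ (n + 1)))
    (hc : ∀ n, IsUnit (1 - c * q ^ (2 * n + 1))) :
    (1 - q) * boundedGF q a c d 1 = 1 := by
  have h := congrArg (PowerSeries.coeff 1) (functional_equations (a := a) (d := d) hq hc).1
  have key1 : ∀ (f : PowerSeries R), PowerSeries.coeff 1 (PowerSeries.X ^ 2 * f) = 0 :=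
    fun f => by rw [PowerSeries.coeff_X_pow_mul']; simp
  have k1 : ∀ (f : PowerSeries R), PowerSeries.coeff 1 (PowerSeries.X * f) =
    PowerSeries.coeff 0 f := fun f => PowerSeries.coeff_succ_X_mul 0 f
  simp only [sub_mul, add_mul, one_mul, mul_assoc, map_sub, map_add (PowerSeries.coeff 1),
    PowerSeries.coeff_C_mul, key1, k1, PowerSeries.coeff_rescale] at h
  change boundedGF q a c d 1 - boundedGF q a c d 0 = _ * boundedGF q a c d 1 + _ +
    (_ * (_ * followGF q a c d 0) + _ * (_ * followGF q a c d 0)) at h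
  rw [boundedGF_zero, followGF_zero] at h
  linear_combination h

/-- Counterpart of `sizeLtGF_succ` at size `m + 1`: the three terms stand for `G(m+1) + b_(m+1)`,
for `a_(m+1)`, and for `c_(m+1) + d_(m+1)`. -/
lemma boundedGF_add_two (hq : ∀ n, IsUnit (1 - q ^ (n + 1)))
    (hc : ∀ n, IsUnit (1 - c * q ^ (2 * n + 1))) (m : ℕ) :
    (1 - q ^ (m + 2)) * boundedGF q a c d (m + 2) =
      boundedGF q a c d (m + 1) + a * q ^ (m + 1) * boundedGF q a c d m +
        (c + d) * q ^ (m + 1) * followGF q a c d (m + 1) := by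
  have h := congrArg (PowerSeries.coeff (m + 2))
    (functional_equations (a := a) (d := d) hq hc).1
  have key1 : ∀ (f : PowerSeries R), PowerSeries.coeff (m + 2) (PowerSeries.X ^ 2 * f) =
    PowerSeries.coeff m f := fun f => by rw [PowerSeries.coeff_X_pow_mul]
  have k1 : ∀ (f : PowerSeries R), PowerSeries.coeff (m + 2) (PowerSeries.X * f) =
    PowerSeries.coeff (m + 1) f := fun f => PowerSeries.coeff_succ_X_mul _ f
  simp only [sub_mul, add_mul, one_mul, mul_assoc, map_sub,
    map_add (PowerSeries.coeff (m + 2)),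
    PowerSeries.coeff_C_mul, key1, k1, PowerSeries.coeff_rescale] at h
  change boundedGF q a c d (m + 2) - boundedGF q a c d (m + 1) =
    _ * boundedGF q a c d (m + 2) + _ * (_ * (_ * boundedGF q a c d m)) +
    (_ * (_ * followGF q a c d (m + 1)) + _ * (_ * followGF q a c d (m + 1))) at h
  linear_combination h

/-- Counterpart of `headGF_follows_c`: the part after `(m+1)_c` has size at most `m` but is not
`m_d`, or is `(m+1)_a` or `(m+1)_c`. -/
lemma followGF_succ (hq : ∀ n, IsUnit (1 - q ^ (n + 1)))
    (hc : ∀ n, IsUnit (1 - c * q ^ (2 * n + 1))) (m : ℕ) :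
    followGF q a c d (m + 1) = c * q ^ (m + 1) * followGF q a c d (m + 1) -
      d * q ^ m * followGF q a c d m + a * q ^ (m + 1) * boundedGF q a c d m +
      (1 - q ^ (m + 1)) * boundedGF q a c d (m + 1) := by
  have h := congrArg (PowerSeries.coeff (m + 1))
    (functional_equations (a := a) (d := d) hq hc).2
  simp only [sub_mul, mul_assoc, map_sub (PowerSeries.coeff (m + 1)),
    map_add (PowerSeries.coeff (m + 1)), PowerSeries.coeff_succ_X_mul,
    PowerSeries.coeff_C_mul, PowerSeries.coeff_rescale] at h
  change followGF q a c d (m + 1) = _ * (_ * followGF q a c d (m + 1)) -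
    _ * (_ * followGF q a c d m) + _ * (_ * (_ * boundedGF q a c d m)) +
    boundedGF q a c d (m + 1) - _ * boundedGF q a c d (m + 1) at h
  linear_combination h

lemma boundedGF_eq_sum (hq : ∀ n, IsUnit (1 - q ^ (n + 1))) (m : ℕ) :
    boundedGF q a c d m = ∑ j ∈ Finset.range (m + 1),
      q ^ j * eulerCoeff q j * hyperCoeff q a c d ((m - j) / 2) := by
  have h : eulerSeries q * evenSeries q a c d = PowerSeries.rescale q (eulerSeries q) *
      PowerSeries.mk (fun m => hyperCoeff q a c d (m / 2)) := by
    have : PowerSeries.mk (fun m => hyperCoeff q a c d (m / 2)) =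
        (1 + PowerSeries.X) * evenSeries q a c d := by
      ext n
      rcases n with _ | n
      · simp [add_mul, evenSeries]
      · simp only [add_mul, one_mul, map_add, PowerSeries.coeff_succ_X_mul, PowerSeries.coeff_mk,
          evenSeries]
        rcases Nat.even_or_odd' n with ⟨k, rfl | rfl⟩
        · have : (2 * k + 1) / 2 = k := by omega
          simp [this]
        · simp [show 2 * k + 1 + 1 = 2 * (k + 1) by ring]
    rw [this]
    linear_combination evenSeries q a c d * eulerSeries_eq hq
  rw [boundedGF, h, PowerSeries.coeff_mul, Finset.Nat.sum_antidiagonal_eq_sum_range_succ_mk]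
  simp [PowerSeries.coeff_rescale, eulerSeries]

/-- Consecutive coefficients differ by a multiple of `q^(2n+1)`, so the sequence is constant modulo
`q^N` from index `N` on. -/
lemma pow_dvd_hyperCoeff_sub (hq : ∀ n, IsUnit (1 - q ^ (n + 1)))
    (hc : ∀ n, IsUnit (1 - c * q ^ (2 * n + 1))) {N n : ℕ} (h : N ≤ n) :
    q ^ N ∣ hyperCoeff q a c d n - hyperCoeff q a c d N := by
  induction n, h using Nat.le_induction with
  | base => simp
  | succ n hn ih =>
    have h1 : hyperCoeff q a c d (n + 1) - hyperCoeff q a c d N = q ^ (2 * n + 1) *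
        (hyperCoeff q a c d (n + 1) * (q + c - c * q ^ (2 * n + 2)) +
          hyperCoeff q a c d n * (a + d + a * d * q ^ (2 * n + 1))) +
        (hyperCoeff q a c d n - hyperCoeff q a c d N) := by
      linear_combination hyperCoeff_succ (a := a) (d := d) hq hc n
    rw [h1]
    exact dvd_add (Dvd.dvd.mul_right (pow_dvd_pow q (by omega)) _) ih

/-- Truncation of `E(q^m) = (1 + q^m) E(q^(m+1))`; the last term is the truncation error. -/
lemma sum_eulerCoeff (hq : ∀ n, IsUnit (1 - q ^ (n + 1))) (K m : ℕ) :
    ∑ j ∈ Finset.range (K + 1), q ^ (m * j) * eulerCoeff q j =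
      (1 + q ^ m) * (∑ j ∈ Finset.range (K + 1), q ^ ((m + 1) * j) * eulerCoeff q j) -
        q ^ m * (q ^ ((m + 1) * K) * eulerCoeff q K) := by
  induction K with
  | zero => simp
  | succ K ih =>
    rw [Finset.sum_range_succ, ih, Finset.sum_range_succ _ (K + 1)]
    linear_combination q ^ (m * (K + 1)) * eulerCoeff_succ hq K

lemma pow_dvd_sum_eulerCoeff_sub (hq : ∀ n, IsUnit (1 - q ^ (n + 1))) {N K : ℕ} (h : N ≤ K) :
    q ^ N ∣ (∑ j ∈ Finset.range (K + 1), q ^ j * eulerCoeff q j) -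
      ∏ i ∈ Finset.range N, (1 + q ^ (i + 1)) := by
  have key : ∀ M, q ^ N ∣ (∑ j ∈ Finset.range (K + 1), q ^ j * eulerCoeff q j) -
      (∏ i ∈ Finset.range M, (1 + q ^ (i + 1))) *
        ∑ j ∈ Finset.range (K + 1), q ^ ((M + 1) * j) * eulerCoeff q j := by
    intro M
    induction M with
    | zero => simp
    | succ M ih =>
      obtain ⟨t, ht⟩ := ih
      -- The truncation error carries a power of `q` of exponent at least `K ≥ N`, so it vanishes
      -- modulo `q^N`.
      have h2 : N + (K - N + (M + 1) * K + (M + 1)) = (M + 1) + (M + 1 + 1) * K := by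
        have := Nat.sub_add_cancel h
        linarith
      have h3 : q ^ (M + 1) * q ^ ((M + 1 + 1) * K) =
          q ^ N * q ^ (K - N + (M + 1) * K + (M + 1)) := by
        rw [← pow_add, ← pow_add, h2]
      refine ⟨t - (∏ i ∈ Finset.range M, (1 + q ^ (i + 1))) *
        (q ^ (K - N + (M + 1) * K + (M + 1)) * eulerCoeff q K), ?_⟩
      rw [Finset.prod_range_succ]
      linear_combination ht +
        (∏ i ∈ Finset.range M, (1 + q ^ (i + 1))) * sum_eulerCoeff hq K (M + 1)
        - (∏ i ∈ Finset.range M, (1 + q ^ (i + 1))) * eulerCoeff q K * h3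
  have h4 : q ^ N ∣ (∑ j ∈ Finset.range (K + 1), q ^ ((N + 1) * j) * eulerCoeff q j) - 1 := by
    rw [Finset.sum_range_succ']
    simp only [mul_zero, pow_zero, eulerCoeff_zero, mul_one, add_sub_cancel_right]
    refine Finset.dvd_sum fun j _ => Dvd.dvd.mul_right (pow_dvd_pow q ?_) _
    nlinarith
  have h5 := dvd_add (key N) (Dvd.dvd.mul_left h4 (∏ i ∈ Finset.range N, (1 + q ^ (i + 1))))
  convert h5 using 1
  ring

/-- Finite form of `(-q;q)_∞ / (q²;q²)_∞ = 1 / (q;q)_∞`. -/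
lemma hyperCoeff_mul_prod (hq : ∀ n, IsUnit (1 - q ^ (n + 1)))
    (hc : ∀ n, IsUnit (1 - c * q ^ (2 * n + 1))) (n : ℕ) :
    hyperCoeff q a c d n * (∏ i ∈ Finset.range n, (1 + q ^ (i + 1))) *
      ((∏ i ∈ Finset.range n, (1 - q ^ (i + 1))) *
        ∏ i ∈ Finset.range n, (1 - c * q ^ (2 * i + 1))) =
      (∏ i ∈ Finset.range n, (1 + a * q ^ (2 * i + 1))) *
        ∏ i ∈ Finset.range n, (1 + d * q ^ (2 * i + 1)) := by
  induction n with
  | zero => simp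
  | succ n ih =>
    simp only [Finset.prod_range_succ]
    linear_combination (1 + a * q ^ (2 * n + 1)) * (1 + d * q ^ (2 * n + 1)) * ih +
      (∏ i ∈ Finset.range n, (1 + q ^ (i + 1))) *
      ((∏ i ∈ Finset.range n, (1 - q ^ (i + 1))) *
        ∏ i ∈ Finset.range n, (1 - c * q ^ (2 * i + 1))) *
      hyperCoeff_succ (a := a) (d := d) hq hc n

lemma pow_dvd_boundedGF_sub (hq : ∀ n, IsUnit (1 - q ^ (n + 1)))
    (hc : ∀ n, IsUnit (1 - c * q ^ (2 * n + 1))) {N m : ℕ} (h : 3 * N ≤ m) :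
    q ^ N ∣ boundedGF q a c d m *
        ((∏ i ∈ Finset.range N, (1 - q ^ (i + 1))) *
          ∏ i ∈ Finset.range N, (1 - c * q ^ (2 * i + 1))) -
      (∏ i ∈ Finset.range N, (1 + a * q ^ (2 * i + 1))) *
        ∏ i ∈ Finset.range N, (1 + d * q ^ (2 * i + 1)) := by
  have h1 : q ^ N ∣ boundedGF q a c d m -
      (∑ j ∈ Finset.range (m + 1), q ^ j * eulerCoeff q j) * hyperCoeff q a c d N := by
    rw [boundedGF_eq_sum hq, Finset.sum_mul, ← Finset.sum_sub_distrib]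
    refine Finset.dvd_sum fun j _ => ?_
    rw [← mul_sub]
    rcases le_or_gt N j with hj | hj
    · rw [mul_assoc]
      exact Dvd.dvd.mul_right (pow_dvd_pow q hj) _
    -- For `j < N` the bound `3N ≤ m` gives `(m - j) / 2 ≥ N`; for `j ≥ N` the factor `q^j` already
    -- suffices.
    · exact Dvd.dvd.mul_left (pow_dvd_hyperCoeff_sub hq hc (by omega)) _
  have h2 := pow_dvd_sum_eulerCoeff_sub hq (show N ≤ m by omega)
  have h3 := (h1.add (h2.mul_right (hyperCoeff q a c d N))).mul_right
    ((∏ i ∈ Finset.range N, (1 - q ^ (i + 1))) *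
          ∏ i ∈ Finset.range N, (1 - c * q ^ (2 * i + 1)))
  rw [← hyperCoeff_mul_prod hq hc]
  convert h3 using 1
  ring

end Algebra

end PrimcPartition

namespace PrimcPartition

/-! ### Recurrences for partitions classified by their largest part. -/

section Combinatorics

open MvPowerSeries

/-- The contribution of a colour to the exponent of the monomial of a partition. -/
noncomputable def Colour.weight : Colour → (Var →₀ ℕ)
  | .a => Finsupp.single Var.a 1
  | .b => 0
  | .c => Finsupp.single Var.c 1
  | .d => Finsupp.single Var.d 1

/-- The exponent of the monomial of a part. -/
noncomputable def Part.weight (x : Part) : Var →₀ ℕ :=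
  Finsupp.single Var.q x.size + x.colour.weight

/-- The exponent of the monomial of a list of parts. -/
noncomputable def weight (l : List Part) : Var →₀ ℕ := (l.map Part.weight).sum

/-- The part `y` may follow the part `x`. -/
def Follows (x y : Part) : Prop :=
  y.le x ∧ y.size + D x.colour y.colour ≤ x.size

lemma Part.le_trans {x y z : Part} (h : x.le y) (h' : y.le z) : x.le z := by
  unfold Part.le at *
  omega

lemma isPartition_nil : IsPartition [] :=
  ⟨by simp, List.Pairwise.nil, List.isChain_nil⟩

/-- The order is transitive, so only the head of the tail constrains a new first part. This makes
recursion on the largest part possible. -/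
lemma isPartition_cons {x : Part} {l : List Part} :
    IsPartition (x :: l) ↔ 1 ≤ x.size ∧ IsPartition l ∧ ∀ y ∈ l.head?, Follows x y := by
  constructor
  · rintro ⟨h1, h2, h3⟩
    rw [List.pairwise_cons] at h2
    rw [List.isChain_cons] at h3
    refine ⟨h1 x (by simp), ⟨fun y hy => h1 y (by simp [hy]), h2.2, h3.2⟩, fun y hy => ?_⟩
    exact ⟨h2.1 y (List.mem_of_mem_head? hy), h3.1 y hy⟩
  · rintro ⟨h1, ⟨h2, h3, h4⟩, h5⟩
    refine ⟨by simpa using ⟨h1, h2⟩, ?_, ?_⟩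
    · rw [List.pairwise_cons]
      refine ⟨fun z hz => ?_, h3⟩
      rcases l with _ | ⟨y, l⟩
      · simp at hz
      · have hy := (h5 y (by simp)).1
        rcases List.mem_cons.1 hz with rfl | hz
        · exact hy
        · exact Part.le_trans ((List.pairwise_cons.1 h3).1 z hz) hy
    · rw [List.isChain_cons]
      exact ⟨fun y hy => (h5 y hy).2, h4⟩

lemma weight_cons (x : Part) (l : List Part) : weight (x :: l) = x.weight + weight l := by
  simp [weight]

lemma weight_apply (l : List Part) :
    weight l Var.q = (l.map Part.size).sum ∧ weight l Var.a = count .a l ∧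
      weight l Var.c = count .c l ∧ weight l Var.d = count .d l := by
  induction l with
  | nil => simp [weight, count]
  | cons x l ih =>
    obtain ⟨k, z⟩ := x
    obtain ⟨h1, h2, h3, h4⟩ := ih
    unfold count at *
    cases z <;>
      simp [weight_cons, Part.weight, Colour.weight, h1, h2, h3, h4, add_comm]

lemma weight_eq_iff {l : List Part} {e : Var →₀ ℕ} :
    weight l = e ↔ (l.map Part.size).sum = e Var.q ∧ count .a l = e Var.a ∧
      count .c l = e Var.c ∧ count .d l = e Var.d := by
  obtain ⟨h1, h2, h3, h4⟩ := weight_apply l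
  rw [← h1, ← h2, ← h3, ← h4]
  constructor
  · rintro rfl
    simp
  · rintro ⟨h1, h2, h3, h4⟩
    ext v
    cases v <;> assumption

instance : Finite Colour :=
  Finite.of_injective (fun z => (⟨z.rank, by cases z <;> decide⟩ : Fin 4)) fun x y h => by
    cases x <;> cases y <;> simp_all [Colour.rank]

lemma finite_isPartition_sum (n : ℕ) :
    {l : List Part | IsPartition l ∧ (l.map Part.size).sum = n}.Finite := by
  induction n using Nat.strong_induction_on with
  | _ n ih =>
    have hfin : (⋃ p : Fin n × Colour, List.cons ⟨p.1 + 1, p.2⟩ ''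
        {l : List Part | IsPartition l ∧ (l.map Part.size).sum = n - (p.1 + 1)}).Finite :=
      Set.finite_iUnion fun p => (ih _ (by have := p.1.2; omega)).image _
    refine (hfin.insert []).subset ?_
    rintro l ⟨hl, hs⟩
    rcases l with _ | ⟨⟨k, z⟩, l⟩
    · simp
    · right
      obtain ⟨h1, h2, -⟩ := isPartition_cons.1 hl
      simp only [List.map_cons, List.sum_cons] at hs h1
      refine Set.mem_iUnion.2 ⟨(⟨k - 1, by omega⟩, z), l, ⟨h2, ?_⟩, ?_⟩
      · simp only
        omega
      · simp only [Nat.sub_add_cancel h1]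

lemma finite_isPartition_weight (e : Var →₀ ℕ) :
    {l : List Part | IsPartition l ∧ weight l = e}.Finite :=
  (finite_isPartition_sum (e Var.q)).subset fun _ h => ⟨h.1, (weight_eq_iff.1 h.2).1⟩

/-- The generating function of the partitions belonging to `S`. -/
noncomputable def gfOn (S : Set (List Part)) : Series :=
  fun e => (({l | IsPartition l ∧ weight l = e} ∩ S).ncard : ℤ)

lemma coeff_gfOn (S : Set (List Part)) (e : Var →₀ ℕ) :
    coeff e (gfOn S) = (({l | IsPartition l ∧ weight l = e} ∩ S).ncard : ℤ) := rfl

/-- The generating function of the partitions which are empty or whose largest part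
satisfies `Q`. -/
noncomputable def headGF (Q : Part → Prop) : Series := gfOn {l | ∀ y ∈ l.head?, Q y}

/-- The generating function of the partitions with largest part `x`. -/
noncomputable def startGF (x : Part) : Series := gfOn {l | l.head? = some x}

lemma genFun_eq_gfOn : genFun = gfOn Set.univ := by
  funext e
  simp only [genFun, gfOn, A, partitions, Set.inter_univ, weight_eq_iff]

lemma gfOn_union {S T : Set (List Part)} (h : Disjoint S T) :
    gfOn (S ∪ T) = gfOn S + gfOn T := by
  ext e
  rw [map_add, coeff_gfOn, coeff_gfOn, coeff_gfOn, Set.inter_union_distrib_left, Set.ncard_union_eq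
    (h.mono Set.inter_subset_right Set.inter_subset_right)
    ((finite_isPartition_weight e).inter_of_left _)
    ((finite_isPartition_weight e).inter_of_left _), Nat.cast_add]

lemma headGF_or {Q : Part → Prop} {x : Part} (h : ¬ Q x) :
    headGF (fun y => Q y ∨ y = x) = headGF Q + startGF x := by
  rw [headGF, headGF, startGF, ← gfOn_union]
  · congr 1
    ext l
    rcases l with _ | ⟨y, l⟩ <;> simp
  · rw [Set.disjoint_left]
    intro l hl hl'
    exact h (hl x hl')

lemma headGF_congr {Q Q' : Part → Prop} (h : ∀ k z, Q ⟨k, z⟩ ↔ Q' ⟨k, z⟩) :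
    headGF Q = headGF Q' := by
  congr 1
  funext x
  exact propext (h x.size x.colour)

lemma headGF_false {Q : Part → Prop} (h : ∀ x, ¬ Q x) : headGF Q = 1 := by
  ext e
  have h1 : {l : List Part | ∀ y ∈ l.head?, Q y} = {[]} := by
    ext l
    rcases l with _ | ⟨y, l⟩ <;> simp [h]
  rw [headGF, h1, coeff_one, coeff_gfOn]
  split_ifs with he
  · rw [Set.inter_eq_right.2]
    · simp
    · rintro _ rfl
      exact ⟨isPartition_nil, by simp [he, weight]⟩
  · have : ({l | IsPartition l ∧ weight l = e} ∩ {[]} : Set (List Part)) = ∅ := by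
      ext l
      simp only [Set.mem_inter_iff, Set.mem_ofPred_eq, Set.mem_singleton_iff,
        Set.mem_empty_iff_false, iff_false]
      rintro ⟨⟨-, h2⟩, rfl⟩
      exact he h2.symm
    simp [this]

lemma startGF_zero (z : Colour) : startGF ⟨0, z⟩ = 0 := by
  ext e
  rw [startGF, coeff_gfOn, coeff_zero]
  have : ({l | IsPartition l ∧ weight l = e} ∩ {l | l.head? = some ⟨0, z⟩} :
      Set (List Part)) = ∅ := by
    ext l
    simp only [Set.mem_inter_iff, Set.mem_ofPred_eq, Set.mem_empty_iff_false, iff_false]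
    rintro ⟨⟨h1, -⟩, h2⟩
    have := h1.pos _ (List.mem_of_mem_head? h2)
    simp at this
  simp [this]

/-- Removing the first part is a bijection onto the partitions that may follow it. -/
lemma startGF_succ (i : ℕ) (z : Colour) :
    startGF ⟨i + 1, z⟩ =
      monomial (Part.weight ⟨i + 1, z⟩) 1 * headGF (Follows ⟨i + 1, z⟩) := by
  set x : Part := ⟨i + 1, z⟩
  ext e
  rw [coeff_monomial_mul, one_mul, startGF, headGF, coeff_gfOn, coeff_gfOn]
  split_ifs with he
  · conv_rhs => rw [← Set.ncard_image_of_injective (f := List.cons x) _ List.cons_injective]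
    congr 2
    ext l
    rcases l with _ | ⟨y, l⟩
    · simp
    · simp only [Set.mem_inter_iff, Set.mem_ofPred_eq, List.head?_cons, Option.some.injEq,
        Set.mem_image, List.cons.injEq, isPartition_cons, weight_cons]
      constructor
      · rintro ⟨⟨⟨h1, h2, h3⟩, h4⟩, rfl⟩
        exact ⟨l, ⟨⟨h2, by rw [← h4, add_tsub_cancel_left]⟩, h3⟩, rfl, rfl⟩
      · rintro ⟨l', ⟨⟨h2, h4⟩, h3⟩, rfl, rfl⟩
        exact ⟨⟨⟨by simp [x], h2, h3⟩, by rw [h4, add_tsub_cancel_of_le he]⟩, rfl⟩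
  · have : ({l | IsPartition l ∧ weight l = e} ∩ {l | l.head? = some x} :
        Set (List Part)) = ∅ := by
      ext l
      simp only [Set.mem_inter_iff, Set.mem_ofPred_eq, Set.mem_empty_iff_false, iff_false]
      rintro ⟨⟨-, h1⟩, h2⟩
      rcases l with _ | ⟨y, l⟩
      · simp at h2
      · simp only [List.head?_cons, Option.some.injEq] at h2
        subst h2
        exact he (by rw [← h1, weight_cons]; exact le_self_add)
    simp [this]

lemma monomial_weight (i : ℕ) :
    monomial (Part.weight ⟨i, .a⟩) (1 : ℤ) = a * q ^ i ∧
    monomial (Part.weight ⟨i, .b⟩) (1 : ℤ) = q ^ i ∧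
    monomial (Part.weight ⟨i, .c⟩) (1 : ℤ) = c * q ^ i ∧
    monomial (Part.weight ⟨i, .d⟩) (1 : ℤ) = d * q ^ i := by
  have hq : q ^ i = monomial (Finsupp.single Var.q i) (1 : ℤ) := X_pow_eq _ _
  rw [hq]
  simp only [a, c, d, X, monomial_mul_monomial, mul_one, Part.weight,
    Colour.weight, add_comm (Finsupp.single Var.q i), zero_add, and_self]

/-- The generating function of the partitions with parts of size less than `m`. -/
noncomputable def sizeLtGF (m : ℕ) : Series := headGF fun y => y.size < m

lemma sizeLtGF_zero : sizeLtGF 0 = 1 := headGF_false (by simp)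

lemma sizeLtGF_succ (i : ℕ) :
    sizeLtGF (i + 1) = sizeLtGF i + startGF ⟨i, .a⟩ + startGF ⟨i, .b⟩ + startGF ⟨i, .c⟩ +
      startGF ⟨i, .d⟩ := by
  rw [sizeLtGF, sizeLtGF, ← headGF_or (by simp), ← headGF_or (by simp), ← headGF_or (by simp),
    ← headGF_or (by simp)]
  apply headGF_congr
  intro k z
  cases z <;> simp <;> omega

/-- Row `a` of `D` permits every size below `i` and, because `D(a,b) = 1`, also `i_b`. -/
lemma startGF_a (i : ℕ) :
    startGF ⟨i + 1, .a⟩ = a * q ^ (i + 1) * (sizeLtGF i + startGF ⟨i, .b⟩) := by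
  rw [startGF_succ, (monomial_weight _).1, sizeLtGF, ← headGF_or (by simp)]
  congr 1
  apply headGF_congr
  intro k z
  cases z <;> simp [Follows, D, Part.le, Colour.rank] <;> omega

lemma startGF_b (i : ℕ) :
    startGF ⟨i + 1, .b⟩ = q ^ (i + 1) * (sizeLtGF (i + 1) + startGF ⟨i + 1, .b⟩) := by
  conv_lhs => rw [startGF_succ, (monomial_weight _).2.1]
  rw [sizeLtGF, ← headGF_or (by simp)]
  congr 1
  apply headGF_congr
  intro k z
  cases z <;> simp [Follows, D, Part.le, Colour.rank] <;> omega

lemma headGF_follows_c (i : ℕ) :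
    headGF (Follows ⟨i + 1, .c⟩) = sizeLtGF i + startGF ⟨i, .a⟩ + startGF ⟨i, .b⟩ +
      startGF ⟨i, .c⟩ + startGF ⟨i + 1, .a⟩ + startGF ⟨i + 1, .c⟩ := by
  rw [sizeLtGF, ← headGF_or (by simp), ← headGF_or (by simp), ← headGF_or (by simp),
    ← headGF_or (by simp), ← headGF_or (by simp)]
  apply headGF_congr
  intro k z
  cases z <;> simp [Follows, D, Part.le, Colour.rank] <;> omega

lemma startGF_c (i : ℕ) :
    startGF ⟨i + 1, .c⟩ = c * q ^ (i + 1) * headGF (Follows ⟨i + 1, .c⟩) := by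
  rw [startGF_succ, (monomial_weight _).2.2.1]

/-- Rows `c` and `d` of `D` agree, and the only followers of equal size have colours `a` and `c`,
which the order allows in both cases. -/
lemma startGF_d (i : ℕ) :
    startGF ⟨i + 1, .d⟩ = d * q ^ (i + 1) * headGF (Follows ⟨i + 1, .c⟩) := by
  rw [startGF_succ, (monomial_weight _).2.2.2]
  congr 1
  apply headGF_congr
  intro k z
  cases z <;> simp [Follows, D, Part.le, Colour.rank]; omega

lemma pow_dvd_genFun_sub {N m : ℕ} (h : N ≤ m) : q ^ N ∣ genFun - sizeLtGF m := by
  rw [X_pow_dvd_iff]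
  intro e he
  rw [map_sub, sub_eq_zero, genFun_eq_gfOn, sizeLtGF, headGF, coeff_gfOn, coeff_gfOn]
  congr 2
  ext l
  simp only [Set.inter_univ, Set.mem_inter_iff, Set.mem_ofPred_eq, weight_eq_iff]
  refine ⟨fun hl => ⟨hl, fun y hy => ?_⟩, fun hl => hl.1⟩
  have h1 : y.size ≤ (l.map Part.size).sum :=
    List.single_le_sum (by simp) _ (List.mem_map_of_mem (List.mem_of_mem_head? hy))
  have := hl.2.1
  omega

end Combinatorics

end PrimcPartition

namespace PrimcPartition

/-! ### Closed forms for bounded partitions and passage to the infinite products. -/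

section Limit

open MvPowerSeries Filter

lemma isUnit_one_sub_q_pow (n : ℕ) : IsUnit (1 - q ^ (n + 1)) := by
  rw [isUnit_iff_constantCoeff]; simp [q]

lemma isUnit_one_sub_c_mul (n : ℕ) : IsUnit (1 - c * q ^ (2 * n + 1)) := by
  rw [isUnit_iff_constantCoeff]; simp [q, c]

/-- The generating functions of bounded partitions in closed form. -/
lemma sizeLtGF_closed_form (m : ℕ) :
    sizeLtGF (m + 1) = (1 - q ^ (m + 1)) * boundedGF q a c d (m + 1) ∧
      sizeLtGF m + startGF ⟨m, .b⟩ = boundedGF q a c d m ∧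
      startGF ⟨m, .c⟩ = c * q ^ m * followGF q a c d m ∧
      startGF ⟨m, .d⟩ = d * q ^ m * followGF q a c d m := by
  have hq := isUnit_one_sub_q_pow
  have hc := isUnit_one_sub_c_mul
  induction m with
  | zero =>
    rw [sizeLtGF_succ]
    -- No part has size `0`, which agrees with the initial values `B(0) = 1` and `F(0) = 0`.
    simp only [startGF_zero, sizeLtGF_zero, boundedGF_zero, followGF_zero, add_zero, mul_zero,
      zero_add, pow_one, and_self, and_true]
    exact (boundedGF_one hq hc).symm
  | succ m ih =>
    obtain ⟨h1, h2, h3, h4⟩ := ih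
    have hb : sizeLtGF (m + 1) + startGF ⟨m + 1, .b⟩ = boundedGF q a c d (m + 1) := by
      apply (hq m).mul_left_cancel
      linear_combination startGF_b m + h1
    have ha := startGF_a m
    rw [h2] at ha
    have hF : headGF (Follows ⟨m + 1, .c⟩) = followGF q a c d (m + 1) := by
      have hu : IsUnit (1 - c * q ^ (m + 1)) := by
        rw [isUnit_iff_constantCoeff]; simp [q, c]
      apply hu.mul_left_cancel
      -- By `sizeLtGF_succ`, the sizes at most `m` without `m_d` contribute `G(m+1) - d_m`; the term
      -- `c_(m+1)` contains the unknown again, whence the cancelled factor `1 - c q^(m+1)`.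
      linear_combination headGF_follows_c m + startGF_c m + ha -
        followGF_succ (a := a) (d := d) hq hc m + h1 - h4 - sizeLtGF_succ m
    have hc' := startGF_c m
    have hd' := startGF_d m
    rw [hF] at hc' hd'
    refine ⟨?_, hb, hc', hd'⟩
    rw [sizeLtGF_succ, boundedGF_add_two hq hc]
    linear_combination hb + ha + hc' + hd'

lemma pow_dvd_genFun_mul_sub (N : ℕ) :
    q ^ N ∣ genFun * ((∏ i ∈ Finset.range N, (1 - q ^ (i + 1))) *
          ∏ i ∈ Finset.range N, (1 - c * q ^ (2 * i + 1))) -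
      (∏ i ∈ Finset.range N, (1 + a * q ^ (2 * i + 1))) *
        ∏ i ∈ Finset.range N, (1 + d * q ^ (2 * i + 1)) := by
  have h1 := pow_dvd_genFun_sub (show N ≤ 3 * N + 1 by omega)
  rw [(sizeLtGF_closed_form _).1] at h1
  have h2 : q ^ N ∣ q ^ (3 * N + 1) * boundedGF q a c d (3 * N + 1) :=
    (pow_dvd_pow q (by omega)).mul_right _
  have h3 := pow_dvd_boundedGF_sub (a := a) (d := d) isUnit_one_sub_q_pow isUnit_one_sub_c_mul
    (show 3 * N ≤ 3 * N + 1 by omega)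
  have h4 := ((h1.sub h2).mul_right ((∏ i ∈ Finset.range N, (1 - q ^ (i + 1))) *
          ∏ i ∈ Finset.range N, (1 - c * q ^ (2 * i + 1)))).add h3
  convert h4 using 1
  ring

lemma eq_of_forall_pow_dvd_sub {f g : Series} (h : ∀ N, q ^ N ∣ f - g) : f = g := by
  ext e
  have := X_pow_dvd_iff.1 (h (e Var.q + 1)) e (Nat.lt_succ_self _)
  rwa [map_sub, sub_eq_zero] at this

section

variable {x y : Series}

lemma pow_dvd_mul_pow (hx : q ∣ x) (hy : q ∣ y) (j : ℕ) : q ^ (j + 1) ∣ x * y ^ j := by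
  rw [pow_succ']
  exact mul_dvd_mul hx (pow_dvd_pow_of_dvd hy j)

lemma multipliable_qFactor (hx : q ∣ x) (hy : q ∣ y) : Multipliable (qFactor x y) := by
  have h : qFactor x y = fun j => 1 + -(x * y ^ j) := by
    funext j
    rw [qFactor, sub_eq_add_neg]
  rw [h]
  apply WithPiTopology.multipliable_one_add_of_tendsto_order_atTop_nhds_top
  refine ENat.tendsto_nhds_top_iff_natCast_lt.mpr fun n => eventually_atTop.mpr ⟨n, fun m hm => ?_⟩
  rw [order_neg]
  have h1 : ((m + 1 : ℕ) : ℕ∞) ≤ (x * y ^ m).order := by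
    -- The order is by total degree, which bounds the degree in `q` from above.
    apply nat_le_order
    intro e he
    refine X_pow_dvd_iff.1 (pow_dvd_mul_pow hx hy m) e (lt_of_le_of_lt ?_ he)
    exact Finsupp.le_degree Var.q e
  refine lt_of_lt_of_le ?_ h1
  exact_mod_cast Nat.lt_succ_of_le hm

lemma pow_dvd_prod_qFactor_sub (hx : q ∣ x) (hy : q ∣ y) {N n : ℕ} (h : N ≤ n) :
    q ^ N ∣ (∏ i ∈ Finset.range n, qFactor x y i) - ∏ i ∈ Finset.range N, qFactor x y i := by
  induction n, h using Nat.le_induction with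
  | base => simp
  | succ n hn ih =>
    have h1 : q ^ N ∣ (∏ i ∈ Finset.range n, qFactor x y i) * (x * y ^ n) :=
      ((pow_dvd_pow q (by omega)).trans (pow_dvd_mul_pow hx hy n)).mul_left _
    convert ih.sub h1 using 1
    rw [Finset.prod_range_succ, qFactor]
    ring

lemma pow_dvd_qPoch_sub (hx : q ∣ x) (hy : q ∣ y) (N : ℕ) :
    q ^ N ∣ qPoch x y - ∏ i ∈ Finset.range N, qFactor x y i := by
  rw [X_pow_dvd_iff]
  intro e he
  rw [map_sub, sub_eq_zero]
  have h1 := (WithPiTopology.tendsto_iff_coeff_tendsto _ _ _).1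
    (multipliable_qFactor hx hy).hasProd.tendsto_prod_nat e
  refine tendsto_nhds_unique h1 (tendsto_const_nhds.congr' ?_)
  filter_upwards [eventually_ge_atTop N] with n hn
  have := X_pow_dvd_iff.1 (pow_dvd_prod_qFactor_sub hx hy hn) e he
  rw [map_sub, sub_eq_zero] at this
  exact this.symm

lemma isUnit_qPoch (hx : q ∣ x) (hy : q ∣ y) : IsUnit (qPoch x y) := by
  obtain ⟨t, ht⟩ := pow_dvd_qPoch_sub hx hy 1
  obtain ⟨s, rfl⟩ := hx
  have h : qPoch (q * s) y = 1 - q * s + q * t := by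
    simp only [Finset.prod_range_one, qFactor, pow_zero, mul_one, pow_one] at ht
    linear_combination ht
  rw [h, isUnit_iff_constantCoeff]
  simp [q]

end

lemma genFun_mul_qPoch :
    genFun * (qPoch q q * qPoch (c * q) (q ^ 2)) =
      qPoch (-(a * q)) (q ^ 2) * qPoch (-(d * q)) (q ^ 2) := by
  apply eq_of_forall_pow_dvd_sub
  intro N
  have hq2 : q ∣ q ^ 2 := dvd_pow_self q two_ne_zero
  obtain ⟨A, hA⟩ := pow_dvd_qPoch_sub (dvd_mul_left q a).neg_right hq2 N
  obtain ⟨B, hB⟩ := pow_dvd_qPoch_sub (dvd_mul_left q d).neg_right hq2 N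
  obtain ⟨C, hC⟩ := pow_dvd_qPoch_sub (dvd_refl q) (dvd_refl q) N
  obtain ⟨E, hE⟩ := pow_dvd_qPoch_sub (dvd_mul_left q c) hq2 N
  obtain ⟨F, hF⟩ := pow_dvd_genFun_mul_sub N
  have ea : ∏ i ∈ Finset.range N, qFactor (-(a * q)) (q ^ 2) i =
      ∏ i ∈ Finset.range N, (1 + a * q ^ (2 * i + 1)) :=
    Finset.prod_congr rfl fun i _ => by rw [qFactor]; ring
  have ed : ∏ i ∈ Finset.range N, qFactor (-(d * q)) (q ^ 2) i =
      ∏ i ∈ Finset.range N, (1 + d * q ^ (2 * i + 1)) :=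
    Finset.prod_congr rfl fun i _ => by rw [qFactor]; ring
  have eq : ∏ i ∈ Finset.range N, qFactor q q i =
      ∏ i ∈ Finset.range N, (1 - q ^ (i + 1)) :=
    Finset.prod_congr rfl fun i _ => by rw [qFactor]; ring
  have ec : ∏ i ∈ Finset.range N, qFactor (c * q) (q ^ 2) i =
      ∏ i ∈ Finset.range N, (1 - c * q ^ (2 * i + 1)) :=
    Finset.prod_congr rfl fun i _ => by rw [qFactor]; ring
  rw [ea] at hA
  rw [ed] at hB
  rw [eq] at hC
  rw [ec] at hE
  refine ⟨F + genFun * (C * qPoch (c * q) (q ^ 2) +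
    (∏ i ∈ Finset.range N, (1 - q ^ (i + 1))) * E) -
    A * qPoch (-(d * q)) (q ^ 2) -
    (∏ i ∈ Finset.range N, (1 + a * q ^ (2 * i + 1))) * B, ?_⟩
  linear_combination hF + genFun * qPoch (c * q) (q ^ 2) * hC +
    genFun * (∏ i ∈ Finset.range N, (1 - q ^ (i + 1))) * hE -
    qPoch (-(d * q)) (q ^ 2) * hA -
    (∏ i ∈ Finset.range N, (1 + a * q ^ (2 * i + 1))) * hB

lemma finite_partitions (n k ℓ m : ℕ) : (partitions n k ℓ m).Finite :=
  (finite_isPartition_sum n).subset fun _ h => ⟨h.1, h.2.1⟩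

end Limit

end PrimcPartition

open PrimcPartition in
theorem theorem1 :
    -- every `A(n; k, ℓ, m)` counts a finite set
    (∀ n k ℓ m : ℕ, (partitions n k ℓ m).Finite) ∧
    -- the four infinite products converge
    (Multipliable (qFactor (-(a * q)) (q ^ 2)) ∧ Multipliable (qFactor (-(d * q)) (q ^ 2)) ∧
      Multipliable (qFactor q q) ∧ Multipliable (qFactor (c * q) (q ^ 2))) ∧
    -- the denominator is invertible
    IsUnit (qPoch q q * qPoch (c * q) (q ^ 2)) ∧
    -- the identity
    genFun = qPoch (-(a * q)) (q ^ 2) * qPoch (-(d * q)) (q ^ 2) *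
      Ring.inverse (qPoch q q * qPoch (c * q) (q ^ 2)) := by
  have hq2 : q ∣ q ^ 2 := dvd_pow_self q two_ne_zero
  have hu : IsUnit (qPoch q q * qPoch (c * q) (q ^ 2)) :=
    (isUnit_qPoch (dvd_refl q) (dvd_refl q)).mul (isUnit_qPoch (dvd_mul_left q c) hq2)
  refine ⟨finite_partitions, ⟨multipliable_qFactor (dvd_mul_left q a).neg_right hq2,
    multipliable_qFactor (dvd_mul_left q d).neg_right hq2,
    multipliable_qFactor (dvd_refl q) (dvd_refl q),
    multipliable_qFactor (dvd_mul_left q c) hq2⟩, hu, ?_⟩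
  rw [← genFun_mul_qPoch, mul_assoc, Ring.mul_inverse_cancel _ hu, mul_one]
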